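/- For integers $1 \le \alpha \le n-1$, the Turán-connected graph $\mathsf{TC}(n,\alpha)$ is obtained from the disjoint union of $\alpha$ cliques with $n$ vertices in total, whose orders differ pairwise by at most one, by choosing a vertex $v$ of one clique of order $\lceil n/\alpha\rceil$ and adding $\alpha-1$ edges, which link $v$ to one vertex of each of the other cliques. (This determines the graph up to isomorphism.) Let $f_{\mathsf{TC}}(n,\alpha)$ be the Fibonacci index of $\mathsf{TC}(n,\alpha)$, that is, the number of its stable (independent) sets of vertices, including the empty set. Then $f_{\mathsf{TC}}$ is strictly increasing in $n$ and in $\alpha$: 1. for every fixed $\alpha \ge 1$, if $\alpha+1 \le n < m$, then $f_{\mathsf{TC}}(n,\alpha) < f_{\mathsf{TC}}(m,\alpha)$; 2. for every fixed $n$, if $1 \le \alpha < \beta \le n-1$, then $f_{\mathsf{TC}}(n,\alpha) < f_{\mathsf{TC}}(n,\beta)$. -/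

import Mathlib

/-- The Fibonacci index of a finite graph: the number of its stable (independent) sets,
including the empty set. -/
noncomputable def fibonacciIndex {V : Type*} [Fintype V] (G : SimpleGraph V) : ℕ :=
  {s : Finset V | G.IsIndepSet (s : Set V)}.ncard

/-- The Turán graph of order `n` with stability number `α` (`1 ≤ α ≤ n`), in the convention
where a Turán graph is a disjoint union of `α` balanced cliques. Mathlib's
`SimpleGraph.turanGraph n α` is the complete balanced `α`-partite graph, so this is its
complement: the cliques are the residue classes modulo `α` in `{0, …, n - 1}`. -/
def turanUnionGraph (n α : ℕ) : SimpleGraph (Fin n) :=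
  (SimpleGraph.turanGraph n α)ᶜ

/-- The Turán-connected graph of order `n` with stability number `α` (`1 ≤ α ≤ n - 1`):
the disjoint union of `α` balanced cliques together with `α - 1` additional edges, which link
one vertex of a largest clique (the vertex `0`; its clique, the residue class of `0` modulo `α`,
has `⌈n / α⌉` vertices) to one vertex of each remaining clique (the vertices `1, …, α - 1`). -/
def turanConnectedGraph (n α : ℕ) : SimpleGraph (Fin n) :=
  turanUnionGraph n α ⊔ SimpleGraph.fromRel fun v w : Fin n =>
    (v : ℕ) = 0 ∧ 1 ≤ (w : ℕ) ∧ (w : ℕ) < α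

/-- `fTC n α` is the Fibonacci index of the Turán-connected graph of order `n` with stability
number `α`, for `1 ≤ α ≤ n - 1`. -/
noncomputable def fTC (n α : ℕ) : ℕ :=
  fibonacciIndex (turanConnectedGraph n α)

namespace TuranConnected

open Finset

/-! For growth in `n`, the smaller graph is induced in the larger one. For growth in `α`, splitting
the stable sets by whether they contain the special vertex `0` gives `closedForm`
(`fTC_eq_closedForm`). Cutting one vertex off a largest clique as a new clique of order 1, linked to
`0`, strictly increases this count. Feeding the new clique one vertex at a time, always from a
largest clique, never decreases it and ends at the balanced graph with one more clique
(`exists_extendedForm_le_closedForm`). -/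

/-! ### Inequalities between the closed forms -/

/-- The Fibonacci index of the Turán-connected graph with `r + p + 1` cliques, of which `r + 1`
have order `q + 1` and `p` have order `q`. -/
def closedForm (q r p : ℕ) : ℕ :=
  (q + 1) ^ (p + 1) * (q + 2) ^ r + (q + 1) ^ r * q ^ p

/-- The Fibonacci index after linking the special vertex of the graph of `closedForm q r p` to one
vertex of an additional clique of order `t`. -/
def extendedForm (q r p t : ℕ) : ℕ :=
  (t + 1) * ((q + 1) ^ (p + 1) * (q + 2) ^ r) + t * ((q + 1) ^ r * q ^ p)

lemma extendedForm_self (q r p : ℕ) : extendedForm q r p q = closedForm q r (p + 1) := by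
  simp only [extendedForm, closedForm]; ring

lemma extendedForm_succ_zero (q r : ℕ) :
    extendedForm q r 0 (q + 1) = closedForm q (r + 1) 0 := by
  simp only [extendedForm, closedForm]; ring

/-- A vertex moves from a non-special clique of order `q + 1` to the clique of order `t`. The
coefficients of both summands grow by `d = q - t`, since `(t + 2)(q + 1) - (t + 1)(q + 2) = (t + 1)q
- t(q + 1) = d`. -/
lemma extendedForm_le_move {q t : ℕ} (r p : ℕ) (h : t ≤ q) :
    extendedForm q (r + 1) p t ≤ extendedForm q r (p + 1) (t + 1) := by
  obtain ⟨d, rfl⟩ := Nat.exists_eq_add_of_le h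
  have e : extendedForm (t + d) r (p + 1) (t + 1) = extendedForm (t + d) (r + 1) p t
      + (d * ((t + d + 1) ^ (p + 1) * (t + d + 2) ^ r) + d * ((t + d + 1) ^ r * (t + d) ^ p)) := by
    simp only [extendedForm]; ring
  omega

/-- Here only the special clique has the larger order `q + 2`, so it gives up the vertex. All old
cliques then have order `q + 1`. -/
lemma extendedForm_le_move_zero {q t : ℕ} (p : ℕ) (h : t ≤ q) :
    extendedForm (q + 1) 0 p t ≤ extendedForm q p 0 (t + 1) := by
  obtain ⟨d, rfl⟩ := Nat.exists_eq_add_of_le h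
  have e : extendedForm (t + d) p 0 (t + 1) = extendedForm (t + d + 1) 0 p t
      + (d * (t + d + 2) ^ p + (t + d + 1) ^ p) := by
    simp only [extendedForm]; ring
  omega

/-- Moving vertices one by one into the additional clique balances the orders without decreasing
the Fibonacci index. -/
lemma exists_extendedForm_le_closedForm (q : ℕ) : ∀ r p t : ℕ, (t ≤ q ∨ t = q + 1 ∧ p = 0) →
    ∃ q' r' p', r' + p' = r + p + 1 ∧
      q' * (r' + p' + 1) + r' + 1 = q * (r + p + 1) + r + 1 + t ∧
      extendedForm q r p t ≤ closedForm q' r' p' := by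
  induction q with
  | zero =>
    rintro r p t (h | ⟨rfl, rfl⟩)
    · obtain rfl : t = 0 := by omega
      exact ⟨0, r, p + 1, by omega, by ring, (extendedForm_self 0 r p).le⟩
    · exact ⟨0, r + 1, 0, by omega, by ring, (extendedForm_succ_zero 0 r).le⟩
  | succ q ihq =>
    intro r
    induction r with
    | zero =>
      rintro p t (h | ⟨rfl, rfl⟩)
      · rcases h.lt_or_eq with h | rfl
        · have ht : t ≤ q := by omega
          -- The new order `t + 1` may reach `q + 1`; this is where the second alternative of the
          -- hypothesis, with no smaller clique left, is needed.
          obtain ⟨q', r', p', h1, h2, h3⟩ := ihq p 0 (t + 1) (by omega)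
          refine ⟨q', r', p', by omega, ?_, (extendedForm_le_move_zero p ht).trans h3⟩
          rw [h2]; ring
        · exact ⟨q + 1, 0, p + 1, by omega, by ring, (extendedForm_self _ 0 p).le⟩
      · exact ⟨q + 1, 0 + 1, 0, by omega, by ring, (extendedForm_succ_zero _ 0).le⟩
    | succ r ihr =>
      rintro p t (h | ⟨rfl, rfl⟩)
      · rcases h.lt_or_eq with h | rfl
        · obtain ⟨q', r', p', h1, h2, h3⟩ := ihr (p + 1) (t + 1) (by omega)
          refine ⟨q', r', p', by omega, ?_, (extendedForm_le_move r p h.le).trans h3⟩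
          rw [h2]; ring
        · exact ⟨q + 1, r + 1, p + 1, by omega, by ring, (extendedForm_self _ _ p).le⟩
      · exact ⟨q + 1, r + 1 + 1, 0, by omega, by ring, (extendedForm_succ_zero _ _).le⟩

/-- The stable sets avoiding `0` gain `q` times the right side of `hX`; those containing `0` lose
only its left side. -/
lemma closedForm_lt_extendedForm_one {q : ℕ} (hq : 1 ≤ q) (r p : ℕ) :
    closedForm q (r + 1) p < extendedForm q r (p + 1) 1 := by
  have hX : (q + 1) ^ r * q ^ p < (q + 1) ^ (p + 1) * (q + 2) ^ r := by
    rw [mul_comm]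
    apply Nat.mul_lt_mul_of_lt_of_le
    · calc q ^ p ≤ (q + 1) ^ p := Nat.pow_le_pow_left (by omega) p
        _ < (q + 1) ^ (p + 1) := Nat.pow_lt_pow_right (by omega) (by omega)
    · exact Nat.pow_le_pow_left (by omega) r
    · positivity
  obtain ⟨d, rfl⟩ := Nat.exists_eq_add_of_le' hq
  have e : extendedForm (d + 1) r (p + 1) 1 + (d + 1 + 1) ^ r * (d + 1) ^ p
      = closedForm (d + 1) (r + 1) p + (d + 1) * ((d + 1 + 1) ^ (p + 1) * (d + 1 + 2) ^ r) := by
    simp only [extendedForm, closedForm]; ring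
  have := Nat.le_mul_of_pos_left ((d + 1 + 1) ^ (p + 1) * (d + 1 + 2) ^ r) d.succ_pos
  rw [Nat.succ_eq_add_one] at this
  omega

/-- The vertex now leaves the special clique, so the summand for stable sets containing `0` is
unchanged. -/
lemma closedForm_lt_extendedForm_one_zero {q : ℕ} (hq : 1 ≤ q) (p : ℕ) :
    closedForm (q + 1) 0 p < extendedForm q p 0 1 := by
  obtain ⟨d, rfl⟩ := Nat.exists_eq_add_of_le' hq
  have e : extendedForm (d + 1) p 0 1 = closedForm (d + 1 + 1) 0 p + (d + 1) * (d + 3) ^ p := by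
    simp only [extendedForm, closedForm]; ring
  have : 0 < (d + 1) * (d + 3) ^ p := by positivity
  omega

/-- For a fixed number of vertices, some balanced configuration with one more clique has a larger
Fibonacci index. -/
lemma exists_closedForm_lt {q r p : ℕ} (h : r + p + 1 + 2 ≤ q * (r + p + 1) + r + 1) :
    ∃ q' r' p', r' + p' = r + p + 1 ∧
      q' * (r' + p' + 1) + r' + 1 = q * (r + p + 1) + r + 1 ∧
      closedForm q r p < closedForm q' r' p' := by
  obtain _ | q := q
  · omega
  obtain _ | r := r
  · obtain _ | q := q
    · omega
    obtain ⟨q', r', p', h1, h2, h3⟩ :=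
      exists_extendedForm_le_closedForm (q + 1) p 0 1 (by omega)
    refine ⟨q', r', p', by omega, ?_,
      (closedForm_lt_extendedForm_one_zero (by omega) p).trans_le h3⟩
    rw [h2]; ring
  · obtain ⟨q', r', p', h1, h2, h3⟩ :=
      exists_extendedForm_le_closedForm (q + 1) r (p + 1) 1 (by omega)
    refine ⟨q', r', p', by omega, ?_, (closedForm_lt_extendedForm_one (by omega) r p).trans_le h3⟩
    rw [h2]; ring

/-! ### Counting sets by their traces -/

/-- The subsets of `T` with at most one element. -/
def smallSubsets {V : Type*} (T : Finset V) : Finset (Finset V) :=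
  T.powerset.filter fun s => s.card ≤ 1

lemma mem_smallSubsets {V : Type*} {T s : Finset V} :
    s ∈ smallSubsets T ↔ s ⊆ T ∧ ∀ a ∈ s, ∀ b ∈ s, a = b := by
  simp [smallSubsets, Finset.card_le_one]

lemma card_smallSubsets {V : Type*} [DecidableEq V] (T : Finset V) :
    (smallSubsets T).card = T.card + 1 := by
  have : smallSubsets T = insert ∅ (T.image fun a => {a}) := by
    ext s
    simp only [smallSubsets, mem_filter, mem_powerset, mem_insert, mem_image]
    constructor
    · rintro ⟨h, hs⟩
      rcases s.eq_empty_or_nonempty with rfl | hne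
      · exact Or.inl rfl
      · obtain ⟨a, rfl⟩ := Finset.card_eq_one.1 (le_antisymm hs hne.card_pos)
        exact Or.inr ⟨a, by simpa using h, rfl⟩
    · rintro (rfl | ⟨a, ha, rfl⟩) <;> simp_all
  rw [this, card_insert_of_notMem (by simp), card_image_of_injective _ singleton_injective]

/-- Sets of vertices whose trace on each colour class lies in a given family correspond to
families of traces. -/
lemma card_filter_forall_trace {V ι : Type*} [Fintype V] [DecidableEq V] [Fintype ι]
    [DecidableEq ι] (col : V → ι) (F : ι → Finset (Finset V))
    [DecidablePred fun s : Finset V => ∀ c, (s.filter fun v => col v = c) ∈ F c]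
    (hF : ∀ c, ∀ s ∈ F c, ∀ v ∈ s, col v = c) :
    (univ.filter fun s : Finset V => ∀ c, (s.filter fun v => col v = c) ∈ F c).card
      = ∏ c, (F c).card := by
  rw [← Fintype.card_piFinset]
  refine Finset.card_nbij' (fun s c => s.filter fun v => col v = c)
    (fun g => univ.filter fun v => v ∈ g (col v)) ?_ ?_ ?_ ?_
  · intro s hs
    simpa using hs
  · intro g hg
    simp only [Fintype.coe_piFinset, Set.mem_pi, Set.mem_univ, mem_coe, forall_true_left] at hg
    simp only [coe_filter, mem_univ, true_and, Set.mem_ofPred_eq]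
    intro c
    convert hg c using 1
    ext v
    simp only [mem_filter, mem_univ, true_and]
    constructor
    · rintro ⟨h, rfl⟩; exact h
    · intro h
      have := hF c _ (hg c) v h
      subst this
      exact ⟨h, rfl⟩
  · intro s _
    ext v
    simp
  · intro g hg
    simp only [Fintype.coe_piFinset, Set.mem_pi, Set.mem_univ, mem_coe, forall_true_left] at hg
    funext c
    ext v
    simp only [mem_filter, mem_univ, true_and]
    constructor
    · rintro ⟨h, rfl⟩; exact h
    · intro h
      have := hF c _ (hg c) v h
      subst this
      exact ⟨h, rfl⟩

/-! ### Adjacency and growth in `n` -/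

lemma turanConnectedGraph_adj {n α : ℕ} {v w : Fin n} :
    (turanConnectedGraph n α).Adj v w ↔ v ≠ w ∧ ((v : ℕ) % α = w % α ∨
      ((v : ℕ) = 0 ∧ 1 ≤ (w : ℕ) ∧ (w : ℕ) < α) ∨ ((w : ℕ) = 0 ∧ 1 ≤ (v : ℕ) ∧ (v : ℕ) < α)) := by
  simp only [turanConnectedGraph, turanUnionGraph, SimpleGraph.sup_adj, SimpleGraph.compl_adj,
    SimpleGraph.turanGraph, SimpleGraph.fromRel_adj]
  tauto

/-- Adjacency depends only on the values of the vertices, so stable sets stay stable under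
`Fin.castSucc`; the singleton of the last vertex is new. -/
lemma fTC_lt_succ (n α : ℕ) : fTC n α < fTC (n + 1) α := by
  unfold fTC fibonacciIndex
  rw [← Set.ncard_image_of_injective _ (Finset.map_injective (Fin.castSuccEmb (n := n)))]
  refine Set.ncard_lt_ncard ⟨?_, fun h => ?_⟩ (Set.toFinite _)
  · rintro _ ⟨s, hs, rfl⟩
    simp only [Set.mem_ofPred_eq, SimpleGraph.isIndepSet_iff, Finset.coe_map] at hs ⊢
    rintro _ ⟨a, ha, rfl⟩ _ ⟨b, hb, rfl⟩ hab
    have := hs ha hb (by rintro rfl; exact hab rfl)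
    simpa [turanConnectedGraph_adj] using this
  · obtain ⟨s, -, hs⟩ := @h {Fin.last n} (by simp [SimpleGraph.isIndepSet_iff])
    have : Fin.last n ∈ s.map Fin.castSuccEmb := by rw [hs]; simp
    obtain ⟨a, -, ha⟩ := Finset.mem_map.1 this
    exact (Fin.castSucc_lt_last a).ne ha

/-! ### Evaluation of `fTC` -/

/-- The residue class modulo `m + 1`. -/
def residue (n m : ℕ) (v : Fin n) : Fin (m + 1) := Fin.ofNat (m + 1) v

lemma residue_eq_iff {n m : ℕ} {v : Fin n} {c : Fin (m + 1)} :
    residue n m v = c ↔ (v : ℕ) % (m + 1) = c := by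
  simp [residue, Fin.ext_iff]

/-- The residue class of `c` in `{0, …, n - 1}`. -/
def residueClass (n m : ℕ) (c : Fin (m + 1)) : Finset (Fin n) :=
  univ.filter fun v => residue n m v = c

lemma card_residueClass {q r p : ℕ} (c : Fin (r + p + 1)) :
    (residueClass (q * (r + p + 1) + r + 1) (r + p) c).card
      = if (c : ℕ) ≤ r then q + 1 else q := by
  have hc := c.isLt
  have h1 : (residueClass (q * (r + p + 1) + r + 1) (r + p) c).card
      = (q * (r + p + 1) + r + 1).count (· ≡ c [MOD (r + p + 1)]) := by
    rw [Nat.count_eq_card_filter_range]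
    refine Finset.card_bij (fun v _ => v) ?_ (fun _ _ _ _ h => Fin.ext h) ?_
    · intro v hv
      rw [mem_filter, mem_range, Nat.ModEq, Nat.mod_eq_of_lt hc]
      exact ⟨v.isLt, by simpa [residueClass, residue_eq_iff] using hv⟩
    · intro v hv
      simp only [mem_filter, mem_range, Nat.ModEq, Nat.mod_eq_of_lt hc] at hv
      exact ⟨⟨v, hv.1⟩, by simpa [residueClass, residue_eq_iff] using hv.2, rfl⟩
  rw [h1, Nat.count_modEq_card _ (by omega), Nat.mod_eq_of_lt hc]
  rcases Nat.eq_zero_or_pos p with rfl | hp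
  · have : q * (r + 0 + 1) + r + 1 = (r + 0 + 1) * (q + 1) := by ring
    rw [this, Nat.mul_div_cancel_left _ (by omega), Nat.mul_mod_right]
    simp; omega
  · have h : q * (r + p + 1) + r + 1 = (r + 1) + (r + p + 1) * q := by ring
    rw [h, Nat.add_mul_div_left _ _ (by omega), Nat.add_mul_mod_self_left,
      Nat.mod_eq_of_lt (by omega : r + 1 < r + p + 1), Nat.div_eq_of_lt (by omega)]
    split_ifs <;> omega

/-- The family of possible traces on the residue classes of the stable sets avoiding `0`. -/
def tracesAvoiding {n m : ℕ} (h : m + 1 ≤ n) : Fin (m + 1) → Finset (Finset (Fin n)) :=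
  Fin.cases (smallSubsets ((residueClass n m 0).erase (Fin.castLE h 0)))
    fun i => smallSubsets (residueClass n m i.succ)

/-- The family of possible traces on the residue classes of the stable sets containing `0`. -/
def tracesContaining {n m : ℕ} (h : m + 1 ≤ n) : Fin (m + 1) → Finset (Finset (Fin n)) :=
  Fin.cases {{Fin.castLE h 0}}
    fun i => smallSubsets ((residueClass n m i.succ).erase (Fin.castLE h i.succ))

lemma residue_castLE {n m : ℕ} (h : m + 1 ≤ n) (c : Fin (m + 1)) :
    residue n m (Fin.castLE h c) = c := by
  rw [residue_eq_iff]
  exact Nat.mod_eq_of_lt c.isLt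

lemma castLE_mem_residueClass {n m : ℕ} (h : m + 1 ≤ n) (c : Fin (m + 1)) :
    Fin.castLE h c ∈ residueClass n m c := by
  simp [residueClass, residue_castLE]

lemma forall_trace_mem_tracesAvoiding {n m : ℕ} (h : m + 1 ≤ n) (s : Finset (Fin n)) :
    (∀ c, (s.filter fun v => residue n m v = c) ∈ tracesAvoiding h c) ↔
      Set.InjOn (residue n m) s ∧ Fin.castLE h 0 ∉ s := by
  have h0 := residue_castLE h 0
  simp only [Fin.forall_fin_succ, tracesAvoiding, Fin.cases_zero, Fin.cases_succ,
    mem_smallSubsets, subset_iff, mem_filter, mem_erase, residueClass, mem_univ, true_and]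
  constructor
  · rintro ⟨⟨h1, h2⟩, h3⟩
    refine ⟨fun a ha b hb hab => ?_, fun h4 => (h1 ⟨h4, h0⟩).1 rfl⟩
    rcases Fin.eq_zero_or_eq_succ (residue n m b) with hc | ⟨c, hc⟩
    · exact h2 a ⟨ha, hab.trans hc⟩ b ⟨hb, hc⟩
    · exact (h3 c).2 a ⟨ha, hab.trans hc⟩ b ⟨hb, hc⟩
  · rintro ⟨h1, h2⟩
    refine ⟨⟨fun v hv => ⟨?_, hv.2⟩, fun a ha b hb => h1 ha.1 hb.1 (ha.2.trans hb.2.symm)⟩,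
      fun c => ⟨fun v hv => hv.2, fun a ha b hb => h1 ha.1 hb.1 (ha.2.trans hb.2.symm)⟩⟩
    rintro rfl
    exact h2 hv.1

lemma forall_trace_mem_tracesContaining {n m : ℕ} (h : m + 1 ≤ n) (s : Finset (Fin n)) :
    (∀ c, (s.filter fun v => residue n m v = c) ∈ tracesContaining h c) ↔
      Set.InjOn (residue n m) s ∧ Fin.castLE h 0 ∈ s ∧ ∀ i : Fin m, Fin.castLE h i.succ ∉ s := by
  have h0 := residue_castLE h 0
  simp only [Fin.forall_fin_succ, tracesContaining, Fin.cases_zero, Fin.cases_succ, mem_singleton,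
    mem_smallSubsets, subset_iff, mem_filter, mem_erase, residueClass, mem_univ, true_and]
  constructor
  · rintro ⟨h1, h2⟩
    have h1' : ∀ v, v ∈ s ∧ residue n m v = 0 ↔ v = Fin.castLE h 0 := by
      simpa [Finset.ext_iff] using h1
    refine ⟨fun a ha b hb hab => ?_, ((h1' _).2 rfl).1,
      fun i hi => ((h2 i).1 ⟨hi, residue_castLE h _⟩).1 rfl⟩
    rcases Fin.eq_zero_or_eq_succ (residue n m b) with hc | ⟨c, hc⟩
    · exact ((h1' a).1 ⟨ha, hab.trans hc⟩).trans ((h1' b).1 ⟨hb, hc⟩).symm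
    · exact (h2 c).2 a ⟨ha, hab.trans hc⟩ b ⟨hb, hc⟩
  · rintro ⟨h1, h2, h3⟩
    refine ⟨?_, fun c => ⟨fun v hv => ⟨?_, hv.2⟩,
      fun a ha b hb => h1 ha.1 hb.1 (ha.2.trans hb.2.symm)⟩⟩
    · ext v
      simp only [mem_filter, mem_singleton]
      exact ⟨fun hv => h1 hv.1 h2 (hv.2.trans h0.symm), by rintro rfl; exact ⟨h2, h0⟩⟩
    · rintro rfl
      exact h3 c hv.1

lemma isIndepSet_turanConnectedGraph_iff {n m : ℕ} (h : m + 1 ≤ n) (s : Finset (Fin n)) :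
    (turanConnectedGraph n (m + 1)).IsIndepSet (s : Set (Fin n)) ↔
      Set.InjOn (residue n m) s ∧
        (Fin.castLE h 0 ∈ s → ∀ i : Fin m, Fin.castLE h i.succ ∉ s) := by
  have hres : ∀ v w : Fin n, residue n m v = residue n m w ↔
      (v : ℕ) % (m + 1) = w % (m + 1) := fun v w => by
    rw [residue_eq_iff]; simp [residue]
  have hval : ∀ v w : Fin n, Fin.castLE h 0 ∈ s → (∀ i : Fin m, Fin.castLE h i.succ ∉ s) →
      w ∈ s → ¬((v : ℕ) = 0 ∧ 1 ≤ (w : ℕ) ∧ (w : ℕ) < m + 1) := by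
    rintro v w - h3 hw ⟨-, h4, h5⟩
    refine h3 ⟨w - 1, by omega⟩ ?_
    convert hw using 1
    ext
    simp
    omega
  simp only [SimpleGraph.isIndepSet_iff, Set.Pairwise, turanConnectedGraph_adj, mem_coe]
  constructor
  · intro hs
    refine ⟨fun a ha b hb hab => ?_, fun h0 i hi => ?_⟩
    · by_contra hne
      exact hs ha hb hne ⟨hne, Or.inl ((hres a b).1 hab)⟩
    · have hne : Fin.castLE h 0 ≠ Fin.castLE h i.succ := by simp [Fin.ext_iff]
      exact hs h0 hi hne ⟨hne, Or.inr (Or.inl (by simp))⟩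
  · rintro ⟨h1, h2⟩ a ha b hb hne ⟨-, h3 | h3 | h3⟩
    · exact hne (h1 ha hb ((hres a b).2 h3))
    · have : a = Fin.castLE h 0 := by ext; simpa using h3.1
      have h0 : Fin.castLE h 0 ∈ s := this ▸ ha
      exact hval a b h0 (h2 h0) hb h3
    · have : b = Fin.castLE h 0 := by ext; simpa using h3.1
      have h0 : Fin.castLE h 0 ∈ s := this ▸ hb
      exact hval b a h0 (h2 h0) ha h3

lemma fTC_eq_prod_add_prod {n m : ℕ} (h : m + 1 ≤ n) :
    fTC n (m + 1) = ∏ c, (tracesAvoiding h c).card + ∏ c, (tracesContaining h c).card := by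
  classical
  rw [← card_filter_forall_trace (residue n m), ← card_filter_forall_trace (residue n m),
    ← card_union_of_disjoint]
  · rw [fTC, fibonacciIndex, ← Set.ncard_coe_finset]
    congr 1
    ext s
    simp only [Set.mem_ofPred_eq, isIndepSet_turanConnectedGraph_iff h, coe_union, Set.mem_union,
      mem_coe, mem_filter, mem_univ, true_and, forall_trace_mem_tracesAvoiding,
      forall_trace_mem_tracesContaining]
    tauto
  · rw [Finset.disjoint_filter]
    intro s _ h1 h2
    rw [forall_trace_mem_tracesAvoiding] at h1
    rw [forall_trace_mem_tracesContaining] at h2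
    exact h1.2 h2.2.1
  · have h0 := residue_castLE h 0
    refine Fin.cases ?_ fun i => ?_
    · simp [tracesContaining, h0]
    · intro s hs v hv
      have := (mem_smallSubsets.1 hs).1 hv
      simp only [residueClass, mem_erase, mem_filter] at this
      exact this.2.2
  · refine Fin.cases ?_ fun i => ?_
    · intro s hs v hv
      have := (mem_smallSubsets.1 hs).1 hv
      simp only [residueClass, mem_erase, mem_filter] at this
      exact this.2.2
    · intro s hs v hv
      have := (mem_smallSubsets.1 hs).1 hv
      simp only [residueClass, mem_filter] at this
      exact this.2

lemma prod_residue_sizes (q r p : ℕ) (f : ℕ → ℕ) :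
    ∏ i : Fin (r + p), f (if (i.succ : ℕ) ≤ r then q + 1 else q) = f (q + 1) ^ r * f q ^ p := by
  rw [Fin.prod_univ_add]
  congr 1
  · rw [Finset.prod_congr rfl (g := fun _ => f (q + 1)), prod_const, card_univ, Fintype.card_fin]
    intro i _
    rw [if_pos]
    simp
  · rw [Finset.prod_congr rfl (g := fun _ => f q), prod_const, card_univ, Fintype.card_fin]
    intro i _
    rw [if_neg]
    simp

lemma fTC_eq_closedForm {q r p : ℕ} (h : r + p + 1 ≤ q * (r + p + 1) + r + 1) :
    fTC (q * (r + p + 1) + r + 1) (r + p + 1) = closedForm q r p := by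
  rw [fTC_eq_prod_add_prod h, Fin.prod_univ_succ, Fin.prod_univ_succ]
  simp only [tracesAvoiding, tracesContaining, Fin.cases_zero, Fin.cases_succ, card_smallSubsets,
    card_erase_of_mem (castLE_mem_residueClass h _), card_residueClass, card_singleton]
  rw [prod_residue_sizes q r p (· + 1), prod_residue_sizes q r p (· - 1 + 1)]
  have hq : (q - 1 + 1) ^ p = q ^ p := by
    obtain _ | q := q
    -- Truncated subtraction is harmless: if `q = 0`, then `h` leaves no empty clique.
    · obtain rfl : p = 0 := by omega
      rfl
    · rfl
  simp only [closedForm, hq]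
  simp
  ring

/-! ### Growth in `α` -/

lemma exists_balanced_decomposition {n α : ℕ} (hα : 1 ≤ α) (hn : 1 ≤ n) :
    ∃ q r p, α = r + p + 1 ∧ n = q * α + r + 1 := by
  -- Dividing `n - 1` rather than `n` makes the number `r + 1` of largest cliques positive, even
  -- when `α` divides `n`.
  have h := Nat.div_add_mod' (n - 1) α
  have h' := Nat.mod_lt (n - 1) hα
  exact ⟨(n - 1) / α, (n - 1) % α, α - 1 - (n - 1) % α, by omega, by omega⟩

lemma fTC_lt_fTC_succ_right {n α : ℕ} (hα : 1 ≤ α) (h : α + 2 ≤ n) :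
    fTC n α < fTC n (α + 1) := by
  obtain ⟨q, r, p, rfl, rfl⟩ := exists_balanced_decomposition (n := n) hα (by omega)
  obtain ⟨q', r', p', h1, h2, h3⟩ := exists_closedForm_lt h
  rw [fTC_eq_closedForm (by omega), ← h2, ← h1, fTC_eq_closedForm (by omega)]
  exact h3

end TuranConnected

/-- The function `fTC` is defined for `1 ≤ α ≤ n - 1`. It is strictly increasing in `n` for fixed
`α` (where `n` ranges over `n ≥ α + 1`), and strictly increasing in `α` for fixed `n`
(where `α` ranges over `1 ≤ α ≤ n - 1`). -/
theorem proposition4p5 :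
    (∀ α : ℕ, 1 ≤ α → StrictMonoOn (fun n : ℕ => fTC n α) (Set.Ici (α + 1))) ∧
      (∀ n : ℕ, StrictMonoOn (fun α : ℕ => fTC n α) (Set.Ico 1 n)) := by
  refine ⟨fun α _ => (strictMono_nat_of_lt_succ fun n =>
    TuranConnected.fTC_lt_succ n α).strictMonoOn _, fun n α hα β hβ h => ?_⟩
  obtain ⟨hα, -⟩ := hα
  obtain ⟨-, hβ⟩ := hβ
  change fTC n α < fTC n β
  induction β, h using Nat.le_induction with
  | base => exact TuranConnected.fTC_lt_fTC_succ_right hα (by omega)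
  | succ β h ih =>
    exact (ih (by omega)).trans (TuranConnected.fTC_lt_fTC_succ_right (by omega) (by omega))
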